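/- Let $\mathcal C$ be a finite set of $m$ candidates and let $\mathbb N=\{1,2,\dots\}$ be the set of possible voters. A \emph{profile} $A$ assigns to every voter $i$ of a finite, non-empty electorate $N_A\subseteq\mathbb N$ a non-empty ballot $A_i\subseteq\mathcal C$. Profiles $A,A'$ with $N_A\cap N_{A'}=\emptyset$ are \emph{disjoint}, and then $A+A'$ denotes their union, a profile on $N_A\cup N_{A'}$. For a permutation $\pi$ of $\mathbb N$, $\pi(A)$ is the profile on $\pi(N_A)$ with $\pi(A)_{\pi(i)}=A_i$; for a permutation $\tau$ of $\mathcal C$, $\tau(A)$ is the profile on $N_A$ with $\tau(A)_i=\tau(A_i)$. For an integer $j\ge 1$, $jA$ denotes a profile consisting of $j$ pairwise disjoint copies $\pi_1(A),\dots,\pi_j(A)$ of $A$; in $jA+A'$ these copies are also disjoint from $A'$ (the names of the voters in the copies are immaterial under anonymity). A \emph{generator function} $g$ maps every profile $A$ and every $W\subsetneq\mathcal C$ to a (possibly empty) set $g(A,W)\subseteq\mathcal C\setminus W$. It is \begin{itemize} \item \emph{proper} if, for all profiles $A,A'$ and all $W\subsetneq \mathcal C$: $g(\pi(A),W)=g(A,W)$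 for all permutations $\pi$ of $\mathbb N$ (anonymity); $g(\tau(A),\tau(W))=\tau(g(A,W))$ for all permutations $\tau$ of $\mathcal C$ (neutrality); if $|g(A,W)|=1$ and $g(A',W)\neq\emptyset$, then $g(jA+A',W)=g(A,W)$ for some integer $j\ge 1$ (continuity); and for every $x\in\mathcal C\setminus W$ there is a profile $B$ with $g(B,W)=\{x\}$ (non-imposition); \item \emph{consistent} if $g(A+A',W)=g(A,W)\cap g(A',W)$ for all disjoint profiles $A,A'$ and all $W\subsetneq\mathcal C$ such that $g(A,W)\cap g(A',W)\neq\emptyset$ and $g(A+A',W)\neq\emptyset$; \item \emph{complete} if $g(A,W)\ne\emptyset$ for all profiles $A$ and all $W\subsetneq\mathcal C$. \end{itemize} \textbf{Proposition.} Let $g$ be a proper, consistent, and complete generator function. Then for every $W\subsetneq\mathcal C$ there is a weight function $v^W:\{0,\dots,m\}\times\{1,\dots,m\}\to\mathbb R$ such that, for all profiles $A$, $g(A,W)$ is the outcome of $v^W$-weighted approval voting, that is, $$g(A,W)=\Big\{c\in\mathcal C\setminus W:\ \sum_{i\in N_A:\,c\in A_i}v^W(|W\cap A_i|,|A_i|)\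 \ge \sum_{i\in N_A:\,d\in A_i}v^W(|W\cap A_i|,|A_i|)\ \text{ for all } d\in\mathcal C\setminus W\Big\}.$$ -/

import Mathlib

namespace ABCVoting

/-- An approval profile over the candidates `C`: a finite, non-empty electorate (the possible voters
are the positive integers) together with a non-empty approval ballot for each voter in it.
`ballot` is set to `∅` outside the electorate, so that two profiles are equal exactly when they have
the same electorate and the same ballots of these voters. -/
@[ext]
structure Profile (C : Type*) where
  voters : Finset ℕ+
  ballot : ℕ+ → Finset C
  voters_nonempty : voters.Nonempty
  ballot_nonempty : ∀ i ∈ voters, (ballot i).Nonempty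
  ballot_eq_empty : ∀ i, i ∉ voters → ballot i = ∅

namespace Profile

variable {C : Type*}

/-- Two profiles are disjoint if no voter reports a ballot in both. -/
def IsDisjoint (A B : Profile C) : Prop := Disjoint A.voters B.voters

/-- The sum `A + B` of two disjoint profiles. -/
def add (A B : Profile C) (_h : A.IsDisjoint B) : Profile C where
  voters := A.voters ∪ B.voters
  ballot i := if i ∈ A.voters then A.ballot i else B.ballot i
  voters_nonempty := A.voters_nonempty.mono Finset.subset_union_left
  ballot_nonempty i hi := by
    by_cases hA : i ∈ A.voters
    · simpa [hA] using A.ballot_nonempty i hA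
    · have hB : i ∈ B.voters := (Finset.mem_union.mp hi).resolve_left hA
      simpa [hA] using B.ballot_nonempty i hB
  ballot_eq_empty i hi := by
    rw [Finset.mem_union, not_or] at hi
    simpa [hi.1] using B.ballot_eq_empty i hi.2

/-- The profile `π(A)` obtained by renaming every voter `i` to `π i`. -/
def permuteVoters (π : Equiv.Perm ℕ+) (A : Profile C) : Profile C where
  voters := A.voters.map π.toEmbedding
  ballot i := A.ballot (π.symm i)
  voters_nonempty := A.voters_nonempty.map
  ballot_nonempty i hi := A.ballot_nonempty _ (by simpa [Finset.mem_map_equiv] using hi)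
  ballot_eq_empty i hi := A.ballot_eq_empty _ (by simpa [Finset.mem_map_equiv] using hi)

/-- The profile `τ(A)` obtained by renaming every candidate `x` to `τ x`. -/
def permuteCandidates (τ : Equiv.Perm C) (A : Profile C) : Profile C where
  voters := A.voters
  ballot i := (A.ballot i).map τ.toEmbedding
  voters_nonempty := A.voters_nonempty
  ballot_nonempty i hi := (A.ballot_nonempty i hi).map
  ballot_eq_empty i hi := by simp [A.ballot_eq_empty i hi]

/-- `B` is a profile of the form `jA`: it consists of `j` pairwise disjoint copies
`π₁(A), …, π_j(A)` of the profile `A`. -/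
def IsCopies (j : ℕ) (A B : Profile C) : Prop :=
  ∃ π : Fin j → Equiv.Perm ℕ+,
    (∀ s t, s ≠ t → (A.permuteVoters (π s)).IsDisjoint (A.permuteVoters (π t))) ∧
    B.voters = Finset.univ.biUnion (fun t => (A.permuteVoters (π t)).voters) ∧
    ∀ t, ∀ i ∈ (A.permuteVoters (π t)).voters, B.ballot i = (A.permuteVoters (π t)).ballot i

end Profile

variable {C : Type*} [Fintype C] [DecidableEq C]

/-- A generator function maps a profile `A` and a committee `W ≠ C` to a possibly empty subset of
`C \ W`. (The condition forces the value `∅` for the full committee `W = C`, so nothing is added to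
the data by letting `W` range over all committees.) -/
structure Generator (C : Type*) [Fintype C] [DecidableEq C] where
  toFun : Profile C → Finset C → Finset C
  subset_compl : ∀ A W, toFun A W ⊆ Wᶜ

instance : CoeFun (Generator C) (fun _ => Profile C → Finset C → Finset C) := ⟨Generator.toFun⟩

namespace Generator

def Anonymous (g : Generator C) : Prop :=
  ∀ (A : Profile C) (W : Finset C), W ≠ Finset.univ → ∀ π : Equiv.Perm ℕ+,
    g A W = g (A.permuteVoters π) W

def Neutral (g : Generator C) : Prop :=
  ∀ (A : Profile C) (W : Finset C), W ≠ Finset.univ → ∀ τ : Equiv.Perm C,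
    g (A.permuteCandidates τ) (W.map τ.toEmbedding) = (g A W).map τ.toEmbedding

/-- Continuity: if `|g(A,W)| = 1` and `g(A',W) ≠ ∅`, then `g(jA + A', W) = g(A,W)` for some `j ≥ 1`.
The names of the voters in the copies of `A` are left open; they do not matter for anonymous
generator functions. -/
def Continuous (g : Generator C) : Prop :=
  ∀ (A A' : Profile C) (W : Finset C), W ≠ Finset.univ → (g A W).card = 1 → (g A' W).Nonempty →
    ∃ j : ℕ, 1 ≤ j ∧ ∃ B : Profile C, A.IsCopies j B ∧
      ∃ h : B.IsDisjoint A', g (B.add A' h) W = g A W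

def NonImposing (g : Generator C) : Prop :=
  ∀ W : Finset C, W ≠ Finset.univ → ∀ x : C, x ∉ W → ∃ A : Profile C, g A W = {x}

structure Proper (g : Generator C) : Prop where
  anonymous : g.Anonymous
  neutral : g.Neutral
  continuous : g.Continuous
  nonImposing : g.NonImposing

def Consistent (g : Generator C) : Prop :=
  ∀ (A A' : Profile C) (h : A.IsDisjoint A') (W : Finset C), W ≠ Finset.univ →
    (g A W ∩ g A' W).Nonempty → (g (A.add A' h) W).Nonempty →
      g (A.add A' h) W = g A W ∩ g A' W

def Complete (g : Generator C) : Prop :=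
  ∀ (A : Profile C) (W : Finset C), W ≠ Finset.univ → (g A W).Nonempty

end Generator

/-- The `v`-weighted approval score `∑_{i ∈ N_A : c ∈ A_i} v(|W ∩ A_i|, |A_i|)` of the candidate `c`.
Only the values `v x y` with `0 ≤ x ≤ m` and `1 ≤ y ≤ m`, `m = |C|`, are ever used. -/
def score (v : ℕ → ℕ → ℝ) (A : Profile C) (W : Finset C) (c : C) : ℝ :=
  ∑ i ∈ A.voters with c ∈ A.ballot i, v (W ∩ A.ballot i).card (A.ballot i).card

/-- `v`-weighted approval voting, as a generator function: it chooses the candidates outside of `W`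
with maximal `v`-weighted approval score. -/
noncomputable def weightedApproval (v : ℕ → ℕ → ℝ) : Generator C where
  toFun A W := {c ∈ Wᶜ | ∀ d ∈ Wᶜ, score v A W d ≤ score v A W c}
  subset_compl _ _ := Finset.filter_subset _ _

end ABCVoting

/-! Anonymity reduces `g` at a fixed `W` to a rule `h` on multisets of ballots
(`isProperRule_onBallots`). Empty ballots are ignored, and the empty multiset selects all of `Wᶜ`.
Fix `c ≠ d` outside `W`, and record for each ballot type `(|W ∩ S|, |S|)` the number of ballots with
`c` but not `d` minus the number with `d` but not `c`. The vectors of the multisets with `h M = {c}`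
form a semigroup `D` by consistency, and `D` absorbs every integer vector by continuity. Moreover `0
∉ D`: if the vector vanishes, averaging over the symmetries fixing `W`, `c`, `d` makes `M` and its
image under the swap of `c` and `d` indistinguishable (`pairCount_ne_zero`). Hence `D` lies in an
open half-space (`exists_pos_functional_of_semigroup`), whose normal gives the weights. By
neutrality these weights serve all pairs. Adding a multiset that singles out `c` to many copies of
`M` shows that winners have maximal score (`score_le_of_mem`). For the converse, multisets with all
scores equal select all of `Wᶜ`, so they can be added freely; this makes `M` equivalent to its image
under the swap of two candidates tied at the top (`mem_of_score_le`). -/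

/-! ### Separating an absorbing integer semigroup from the origin -/

/-- A real point in the cone spanned by an additive semigroup of integer vectors stays within
bounded distance of the semigroup (with `0` adjoined), along its whole ray. -/
lemma exists_bound_of_mem_span {ι : Type*} [Finite ι] {D : Set (ι → ℤ)}
    (hadd : ∀ a ∈ D, ∀ b ∈ D, a + b ∈ D) {z : ι → ℝ}
    (hz : z ∈ Submodule.span NNReal ((fun (d : ι → ℤ) k => (d k : ℝ)) '' D)) :
    ∃ B : ℝ, ∀ r : ℝ, 0 ≤ r → ∃ a : ι → ℤ, (a = 0 ∨ a ∈ D) ∧ ∀ k, |(a k : ℝ) - r * z k| ≤ B := by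
  cases nonempty_fintype ι
  have hsmul : ∀ d ∈ D, ∀ n : ℕ, n • d = 0 ∨ n • d ∈ D := by
    intro d hd n
    induction n with
    | zero => simp
    | succ n ih =>
      right
      rw [succ_nsmul]
      rcases ih with h | h
      · simpa [h] using hd
      · exact hadd _ h _ hd
  induction hz using Submodule.span_induction with
  | mem z hz =>
    obtain ⟨d, hd, rfl⟩ := hz
    refine ⟨∑ k, |(d k : ℝ)|, fun r hr => ⟨⌈r⌉₊ • d, hsmul d hd _, fun k => ?_⟩⟩
    have h1 : |(((⌈r⌉₊ • d) k : ℤ) : ℝ) - r * d k| = |(⌈r⌉₊ : ℝ) - r| * |(d k : ℝ)| := by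
      rw [← abs_mul]; congr 1; simp; ring
    rw [h1]
    have h2 : |(⌈r⌉₊ : ℝ) - r| ≤ 1 := by
      rw [abs_le]; constructor <;> linarith [Nat.le_ceil r, Nat.ceil_lt_add_one hr]
    calc _ ≤ 1 * |(d k : ℝ)| := by gcongr
      _ ≤ _ := by
        rw [one_mul]
        exact Finset.single_le_sum (f := fun k => |(d k : ℝ)|) (fun _ _ => abs_nonneg _)
          (Finset.mem_univ k)
  | zero => exact ⟨0, fun r _ => ⟨0, Or.inl rfl, by simp⟩⟩
  | add x y _ _ hx hy =>
    obtain ⟨B, hB⟩ := hx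
    obtain ⟨B', hB'⟩ := hy
    refine ⟨B + B', fun r hr => ?_⟩
    obtain ⟨a, ha, h⟩ := hB r hr
    obtain ⟨a', ha', h'⟩ := hB' r hr
    refine ⟨a + a', ?_, fun k => ?_⟩
    · rcases ha with rfl | ha
      · simpa using ha'
      · rcases ha' with rfl | ha'
        · simpa using Or.inr ha
        · exact Or.inr (hadd _ ha _ ha')
    · have : (((a + a') k : ℤ) : ℝ) - r * (x + y) k = (a k - r * x k) + (a' k - r * y k) := by
        simp; ring
      rw [this]
      exact (abs_add_le _ _).trans (add_le_add (h k) (h' k))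
  | smul s x _ hx =>
    obtain ⟨B, hB⟩ := hx
    refine ⟨B, fun r hr => ?_⟩
    -- The bound holds along the whole ray, so rescaling the point keeps the same `B`.
    obtain ⟨a, ha, h⟩ := hB (r * s) (mul_nonneg hr s.2)
    refine ⟨a, ha, fun k => ?_⟩
    have : ((s • x) k : ℝ) = s * x k := rfl
    rw [this, ← mul_assoc]
    exact h k

/-- An additive semigroup of integer vectors that absorbs every vector but does not contain `0`
lies in an open half-space. -/
theorem exists_pos_functional_of_semigroup {ι : Type*} [Fintype ι] {D : Set (ι → ℤ)}
    (hne : D.Nonempty) (hadd : ∀ a ∈ D, ∀ b ∈ D, a + b ∈ D) (h0 : (0 : ι → ℤ) ∉ D)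
    (hopen : ∀ p ∈ D, ∀ y, ∃ j : ℕ, j • p + y ∈ D) :
    ∃ w : ι → ℝ, ∀ p ∈ D, 0 < ∑ i, w i * p i := by
  classical
  obtain ⟨p, hp⟩ := hne
  set K := Submodule.span NNReal ((fun (d : ι → ℤ) k => (d k : ℝ)) '' D) with hK
  have hDK : ∀ d ∈ D, (fun k => (d k : ℝ)) ∈ K := fun d hd =>
    Submodule.subset_span ⟨d, hd, rfl⟩
  have hlarge : ∀ y : ι → ℤ, ∃ j : ℕ, ∀ n, j ≤ n → n • p + y ∈ D := by
    intro y
    obtain ⟨j, hj⟩ := hopen p hp y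
    refine ⟨j, fun n hn => ?_⟩
    induction n, hn using Nat.le_induction with
    | base => exact hj
    | succ n _ ih =>
      rw [succ_nsmul, add_right_comm]
      exact hadd _ ih _ hp
  -- If `-p` lay in the cone, some `a` in the semigroup or `0` would satisfy `a + N • p = e` with
  -- `e` in a box independent of `N`. The box is finite, so one large `N` gives `N • p - e ∈ D` for
  -- all such `e`. But `N • p - e = -a`, which forces `0 ∈ D`.
  have hneg : (fun k => -(p k : ℝ)) ∉ K := by
    intro hmem
    obtain ⟨B, hB⟩ := exists_bound_of_mem_span hadd hmem
    choose J hJ using hlarge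
    have hfin : (Set.Icc (fun _ : ι => -⌈B⌉) (fun _ => ⌈B⌉)).Finite := Set.finite_Icc _ _
    obtain ⟨N, hN⟩ := (hfin.image fun e => J (-e)).bddAbove
    obtain ⟨a, ha, h⟩ := hB N (Nat.cast_nonneg _)
    have he : a + N • p ∈ Set.Icc (fun _ : ι => -⌈B⌉) (fun _ => ⌈B⌉) := by
      have hb : ∀ k, |(a + N • p) k| ≤ ⌈B⌉ := by
        intro k
        have h1 := (h k).trans (Int.le_ceil B)
        rw [mul_neg, sub_neg_eq_add] at h1
        have h2 : ((|(a + N • p) k| : ℤ) : ℝ) ≤ (⌈B⌉ : ℤ) := by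
          simpa using h1
        exact_mod_cast h2
      exact ⟨fun k => (abs_le.mp (hb k)).1, fun k => (abs_le.mp (hb k)).2⟩
    have h1 := hJ (-(a + N • p)) N (hN ⟨_, he, rfl⟩)
    have h2 : N • p + -(a + N • p) = -a := by abel
    rw [h2] at h1
    rcases ha with rfl | ha
    · exact h0 (by simpa using h1)
    · exact h0 (by simpa using hadd _ h1 _ ha)
  let p' : ι → ℝ := fun k => (p k : ℝ)
  have hp0 : p' ≠ 0 := by
    intro h
    refine h0 ?_
    have : p = 0 := by
      ext k
      have := congrFun h k
      simpa [p'] using this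
    rwa [← this]
  -- The functional `t • p' ↦ t` is nonnegative on the part of the cone in the line of `p'`, because
  -- `-p'` is not in the cone; M. Riesz extension applies.
  let f : (ι → ℝ) →ₗ.[ℝ] ℝ := LinearPMap.mkSpanSingleton p' 1 hp0
  have hfapp : ∀ (t : ℝ) (ht : t • p' ∈ f.domain), f ⟨t • p', ht⟩ = t := by
    intro t ht
    have := LinearPMap.mkSpanSingleton'_apply p' (1 : ℝ) (fun c hc => by
      rcases smul_eq_zero.mp hc with h | h
      · simp [h]
      · exact absurd h hp0) t ht
    exact this.trans (by simp)
  have hdom : ∀ x : f.domain, ∃ t : ℝ, t • p' = x := fun x =>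
    Submodule.mem_span_singleton.mp x.2
  have hdom' : ∀ t : ℝ, t • p' ∈ f.domain := fun t => Submodule.mem_span_singleton.mpr ⟨t, rfl⟩
  have hKsmul : ∀ (r : ℝ), 0 ≤ r → ∀ x ∈ K, r • x ∈ K := fun r hr x hx =>
    K.smul_mem (⟨r, hr⟩ : NNReal) hx
  let s : PointedCone ℝ (ι → ℝ) :=
    { carrier := K
      smul_mem' := fun r x hx => hKsmul r r.2 x hx
      zero_mem' := K.zero_mem
      add_mem' := fun hx hy => K.add_mem hx hy }
  have hdense : ∀ y : ι → ℝ, ∃ t : ℝ, t • p' + y ∈ K := by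
    have hadd' : ∀ x y : ι → ℝ, (∃ t : ℝ, t • p' + x ∈ K) → (∃ t : ℝ, t • p' + y ∈ K) →
        ∃ t : ℝ, t • p' + (x + y) ∈ K := by
      rintro x y ⟨t, ht⟩ ⟨u, hu⟩
      refine ⟨t + u, ?_⟩
      have := K.add_mem ht hu
      rw [show (t + u) • p' + (x + y) = t • p' + x + (u • p' + y) by module]
      exact this
    have hint : ∀ (r : ℝ) (y : ι → ℤ), 0 ≤ r → ∃ t : ℝ, t • p' + r • (fun k => (y k : ℝ)) ∈ K := by
      intro r y hr
      obtain ⟨j, hj⟩ := hopen p hp y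
      refine ⟨r * j, ?_⟩
      have := hKsmul r hr _ (hDK _ hj)
      convert this using 1
      ext k
      simp [p']
      ring
    intro y
    rw [← Finset.univ_sum_single y]
    refine Finset.sum_induction _ (fun y => ∃ t : ℝ, t • p' + y ∈ K) hadd' ⟨0, by simp⟩ ?_
    intro i _
    rcases le_total 0 (y i) with h | h
    · convert hint (y i) (Pi.single i 1) h using 5
      ext k
      by_cases hk : k = i <;> simp [Pi.single_apply, hk]
    · convert hint (-y i) (Pi.single i (-1)) (by linarith) using 5
      ext k
      by_cases hk : k = i <;> simp [Pi.single_apply, hk]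
  obtain ⟨φ, hφ, hpos⟩ := riesz_extension s f (by
      intro x hx
      obtain ⟨t, ht⟩ := hdom x
      have hxt : x = ⟨t • p', hdom' t⟩ := Subtype.ext ht.symm
      rw [hxt, hfapp]
      by_contra hlt
      push Not at hlt
      apply hneg
      have hx' : t • p' ∈ K := by rw [ht]; exact hx
      have := hKsmul (-t)⁻¹ (by rw [inv_nonneg]; linarith) _ hx'
      convert this using 1
      ext k
      simp only [p', Pi.smul_apply, smul_eq_mul]
      field_simp [hlt.ne]) (by
      intro y
      obtain ⟨t, ht⟩ := hdense y
      exact ⟨⟨t • p', hdom' t⟩, ht⟩)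
  have hφp : φ p' = 1 := by
    have h1 := hφ ⟨(1 : ℝ) • p', hdom' 1⟩
    rw [hfapp] at h1
    simpa using h1
  refine ⟨fun i => φ (Pi.single i 1), fun q hq => ?_⟩
  have hsum : ∀ q : ι → ℤ, ∑ i, φ (Pi.single i 1) * (q i : ℝ) = φ (fun k => (q k : ℝ)) := by
    intro q
    conv_rhs => rw [LinearMap.pi_apply_eq_sum_univ φ]
    refine Finset.sum_congr rfl fun i _ => ?_
    rw [smul_eq_mul, mul_comm]
    congr 2
    ext k
    simp [Pi.single_apply, eq_comm]
  rw [hsum]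
  -- Absorption upgrades `φ ≥ 0` to strictness: `j • q - p ∈ D` gives `j * φ q ≥ φ p = 1`.
  obtain ⟨j, hj⟩ := hopen q hq (-p)
  have h1 : 0 ≤ φ (fun k => (((j • q + -p) k : ℤ) : ℝ)) := hpos _ (hDK _ hj)
  have h2 : (fun k => (((j • q + -p) k : ℤ) : ℝ)) = (j : ℝ) • (fun k => (q k : ℝ)) - p' := by
    ext k
    simp [p', sub_eq_add_neg]
  rw [h2, map_sub, map_smul, hφp, smul_eq_mul] at h1
  by_contra hle
  push Not at hle
  have := mul_nonpos_of_nonneg_of_nonpos (Nat.cast_nonneg j : (0 : ℝ) ≤ j) hle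
  linarith

namespace ABCVoting

/-! ### Multisets of ballots, renaming and pair counts -/

section Ballots

variable {C : Type*}

/-- Renaming the candidates in a multiset of ballots. -/
def rename (τ : Equiv.Perm C) : Multiset (Finset C) →+ Multiset (Finset C) :=
  Multiset.mapAddMonoidHom (Finset.map τ.toEmbedding)

/-- The sum of `φ` over a multiset of ballots. -/
def ballotSum {A : Type*} [AddCommMonoid A] (φ : Finset C → A) : Multiset (Finset C) →+ A :=
  Multiset.sumAddMonoidHom.comp (Multiset.mapAddMonoidHom φ)

lemma rename_singleton (τ : Equiv.Perm C) (S : Finset C) :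
    rename τ {S} = {S.map τ.toEmbedding} := Multiset.map_singleton _ _

lemma map_perm_mul (τ σ : Equiv.Perm C) (S : Finset C) :
    S.map (τ * σ).toEmbedding = (S.map σ.toEmbedding).map τ.toEmbedding := by
  rw [Finset.map_map]; rfl

lemma rename_rename (τ σ : Equiv.Perm C) (M : Multiset (Finset C)) :
    rename τ (rename σ M) = rename (τ * σ) M := by
  simp only [rename, Multiset.coe_mapAddMonoidHom, Multiset.map_map]
  refine Multiset.map_congr rfl fun S _ => ?_
  exact (map_perm_mul τ σ S).symm

lemma ballotSum_singleton {A : Type*} [AddCommMonoid A] (φ : Finset C → A) (S : Finset C) :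
    ballotSum φ {S} = φ S := by simp [ballotSum]

lemma ballotHom_ext {A : Type*} [AddCommMonoid A] {φ ψ : Multiset (Finset C) →+ A}
    (h : ∀ S, φ {S} = ψ {S}) : φ = ψ := by
  refine DFunLike.ext _ _ fun M => ?_
  induction M using Multiset.induction with
  | empty => simp
  | cons S M ih => rw [← Multiset.singleton_add, map_add, map_add, h, ih]

variable [DecidableEq C]

/-- The weighted approval score of `c` in a multiset of ballots. -/
def ballotScore (v : ℕ → ℕ → ℝ) (W : Finset C) (c : C) : Multiset (Finset C) →+ ℝ :=
  ballotSum fun S => if c ∈ S then v (W ∩ S).card S.card else 0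

lemma map_swap_eq {W : Finset C} {a b : C} (ha : a ∉ W) (hb : b ∉ W) :
    W.map (Equiv.swap a b).toEmbedding = W := by
  ext x
  rw [Finset.mem_map_equiv, Equiv.symm_swap]
  rcases eq_or_ne x a with rfl | hxa
  · simp [ha, hb]
  rcases eq_or_ne x b with rfl | hxb
  · simp [ha, hb]
  rw [Equiv.swap_apply_of_ne_of_ne hxa hxb]

lemma card_inter_map {W : Finset C} {τ : Equiv.Perm C} (hτ : W.map τ.toEmbedding = W)
    (S : Finset C) : (W ∩ S.map τ.toEmbedding).card = (W ∩ S).card := by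
  conv_lhs => rw [← hτ]
  rw [← Finset.map_inter, Finset.card_map]

lemma ballotScore_rename (v : ℕ → ℕ → ℝ) {W : Finset C} {τ : Equiv.Perm C}
    (hτ : W.map τ.toEmbedding = W) (c : C) (M : Multiset (Finset C)) :
    ballotScore v W (τ c) (rename τ M) = ballotScore v W c M := by
  have : (ballotScore v W (τ c)).comp (rename τ) = ballotScore v W c := by
    refine ballotHom_ext fun S => ?_
    rw [AddMonoidHom.comp_apply, rename_singleton, ballotScore, ballotScore, ballotSum_singleton,
      ballotSum_singleton, card_inter_map hτ, Finset.card_map]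
    simp
  exact DFunLike.congr_fun this M

lemma map_swap_eq_self {S : Finset C} {c d : C} (h : c ∈ S ↔ d ∈ S) :
    S.map (Equiv.swap c d).toEmbedding = S := by
  by_cases hc : c ∈ S
  · ext x
    rw [Finset.mem_map_equiv, Equiv.symm_swap]
    rcases eq_or_ne x c with rfl | hxc
    · simp [hc, h.mp hc]
    rcases eq_or_ne x d with rfl | hxd
    · simp [hc, h.mp hc]
    rw [Equiv.swap_apply_of_ne_of_ne hxc hxd]
  · exact map_swap_eq hc (fun hd => hc (h.mpr hd))

/-- The signed number of ballots of each type that separate `c` from `d`. -/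
def pairCount (W : Finset C) (c d : C) (T : Finset (ℕ × ℕ)) :
    Multiset (Finset C) →+ (T → ℤ) :=
  ballotSum fun S p => if ((W ∩ S).card, S.card) = p.1 then
    (if c ∈ S then 1 else 0) - (if d ∈ S then 1 else 0) else 0

lemma pairCount_singleton {W S : Finset C} {c d : C} {T : Finset (ℕ × ℕ)} (hcS : c ∈ S)
    (hdS : d ∉ S) (hT : ((W ∩ S).card, S.card) ∈ T) :
    pairCount W c d T {S} = Pi.single ⟨_, hT⟩ 1 := by
  ext p
  simp [pairCount, ballotSum_singleton, hcS, hdS, Pi.single_apply, Subtype.ext_iff, eq_comm]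

lemma pairCount_singleton_neg {W S : Finset C} {c d : C} {T : Finset (ℕ × ℕ)} (hcS : c ∉ S)
    (hdS : d ∈ S) (hT : ((W ∩ S).card, S.card) ∈ T) :
    pairCount W c d T {S} = Pi.single ⟨_, hT⟩ (-1) := by
  ext p
  simp [pairCount, ballotSum_singleton, hcS, hdS, Pi.single_apply, Subtype.ext_iff, eq_comm]

lemma pairCount_singleton_zero {W S : Finset C} {c d : C} {T : Finset (ℕ × ℕ)}
    (h : c ∈ S ↔ d ∈ S) : pairCount W c d T {S} = 0 := by
  ext p
  by_cases hd : d ∈ S <;> simp [pairCount, ballotSum_singleton, h, hd]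

end Ballots

variable {C : Type*} [Fintype C] [DecidableEq C]

/-- A permutation that matches two colourings exists if all colours are used equally often. -/
lemma exists_perm_of_card_fiber_eq {α κ : Type*} [Fintype α] [DecidableEq κ] {k k' : α → κ}
    (h : ∀ a, (Finset.univ.filter fun x => k x = a).card
      = (Finset.univ.filter fun x => k' x = a).card) :
    ∃ τ : Equiv.Perm α, ∀ x, k' (τ x) = k x := by
  classical
  have e : ∀ a, Nonempty ({x // k x = a} ≃ {x // k' x = a}) := fun a =>
    ⟨Fintype.equivOfCardEq (by rw [Fintype.card_subtype, Fintype.card_subtype, h a])⟩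
  exact ⟨Equiv.ofFiberEquiv fun a => (e a).some, fun x => Equiv.ofFiberEquiv_map _ x⟩

/-- Two ballots of the same type that both contain `c` but not `d` are related by a permutation of
the candidates that fixes `W`, `c` and `d`. -/
lemma exists_perm_map_eq {W R R' : Finset C} {c d : C} (hcW : c ∉ W) (hdW : d ∉ W)
    (hc : c ∈ R) (hd : d ∉ R) (hc' : c ∈ R') (hd' : d ∉ R')
    (hW : (W ∩ R).card = (W ∩ R').card) (hR : R.card = R'.card) :
    ∃ τ : Equiv.Perm C, W.map τ.toEmbedding = W ∧ τ c = c ∧ τ d = d ∧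
      R.map τ.toEmbedding = R' := by
  have hcd : c ≠ d := fun h => hd (h ▸ hc)
  -- The colours encode everything `τ` must preserve; `c` and `d` get colours of their own so that
  -- they are fixed.
  let k : Finset C → C → Fin 6 := fun R x =>
    if x = c then 0 else if x = d then 1 else if x ∈ W then (if x ∈ R then 2 else 3) else
      if x ∈ R then 4 else 5
  have hk0 : ∀ R x, k R x = 0 ↔ x = c := by intro R x; simp only [k]; split_ifs <;> simp_all
  have hk1 : ∀ R x, k R x = 1 ↔ x = d := by
    intro R x; simp only [k]; split_ifs <;> simp_all
  have hkW : ∀ R x, x ∈ W ↔ k R x = 2 ∨ k R x = 3 := by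
    intro R x; simp only [k]; split_ifs <;> simp_all
  have hkR : ∀ R : Finset C, c ∈ R → d ∉ R → ∀ x, x ∈ R ↔ k R x = 0 ∨ k R x = 2 ∨ k R x = 4 := by
    intro R hc hd x; simp only [k]; split_ifs <;> simp_all
  have hf0 : ∀ R, Finset.univ.filter (fun x => k R x = 0) = {c} := by
    intro R; ext x; simp [hk0]
  have hf1 : ∀ R, Finset.univ.filter (fun x => k R x = 1) = {d} := by
    intro R; ext x; simp [hk1]
  have hf2 : ∀ R, Finset.univ.filter (fun x => k R x = 2) = W ∩ R := by
    intro R; ext x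
    simp only [Finset.mem_filter, Finset.mem_univ, true_and, Finset.mem_inter, k]
    split_ifs <;> simp_all
  have hf3 : ∀ R, Finset.univ.filter (fun x => k R x = 3) = W \ R := by
    intro R; ext x
    simp only [Finset.mem_filter, Finset.mem_univ, true_and, Finset.mem_sdiff, k]
    split_ifs <;> simp_all
  have hf4 : ∀ R, d ∉ R → Finset.univ.filter (fun x => k R x = 4) = (R \ W).erase c := by
    intro R hd; ext x
    simp only [Finset.mem_filter, Finset.mem_univ, true_and, Finset.mem_sdiff, Finset.mem_erase, k]
    split_ifs <;> simp_all
  have hf5 : ∀ R, c ∈ R → Finset.univ.filter (fun x => k R x = 5) = (R ∪ W)ᶜ.erase d := by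
    intro R hc; ext x
    simp only [Finset.mem_filter, Finset.mem_univ, true_and, Finset.mem_compl, Finset.mem_union,
      Finset.mem_erase, k]
    split_ifs <;> simp_all
  have hsd : ∀ R : Finset C, (R \ W).card = R.card - (W ∩ R).card := fun R => by
    rw [Finset.card_sdiff]
  have hsd' : ∀ R : Finset C, (W \ R).card = W.card - (W ∩ R).card := fun R => by
    rw [Finset.card_sdiff, Finset.inter_comm]
  obtain ⟨τ, hτ⟩ := exists_perm_of_card_fiber_eq (k := k R) (k' := k R') (by
    intro a
    fin_cases a
    · simp [hf0]
    · simp [hf1]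
    · simp [hf2, hW]
    · simp [hf3, hsd', hW]
    · have h1 : c ∈ R \ W := by simp [hc, hcW]
      have h2 : c ∈ R' \ W := by simp [hc', hcW]
      simp [hf4, hd, hd', Finset.card_erase_of_mem, h1, h2, hsd, hW, hR]
    · have h1 : d ∈ (R ∪ W)ᶜ := by simp [hd, hdW]
      have h2 : d ∈ (R' ∪ W)ᶜ := by simp [hd', hdW]
      have h3 : (R ∪ W).card = (R' ∪ W).card := by
        rw [Finset.card_union, Finset.card_union, Finset.inter_comm R, Finset.inter_comm R', hW, hR]
      simp only [Fin.reduceFinMk]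
      rw [hf5 R hc, hf5 R' hc', Finset.card_erase_of_mem h1, Finset.card_erase_of_mem h2,
        Finset.card_compl, Finset.card_compl, h3])
  refine ⟨τ, ?_, ?_, ?_, ?_⟩
  · ext x
    rw [Finset.mem_map_equiv, hkW R, ← hτ, Equiv.apply_symm_apply, ← hkW]
  · rw [← hk0 R', hτ, hk0]
  · rw [← hk1 R', hτ, hk1]
  · ext x
    rw [Finset.mem_map_equiv, hkR R hc hd, ← hτ, Equiv.apply_symm_apply, ← hkR R' hc' hd']

/-! ### Choice rules on multisets of ballots -/

/-- A complete, consistent and proper choice rule on multisets of ballots, selecting among the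
candidates outside of `W`. -/
structure IsProperRule (W : Finset C) (h : Multiset (Finset C) → Finset C) : Prop where
  subset : ∀ M, h M ⊆ Wᶜ
  nonempty : ∀ M, (h M).Nonempty
  zero : h 0 = Wᶜ
  add : ∀ M N, (h M ∩ h N).Nonempty → h (M + N) = h M ∩ h N
  rename : ∀ τ : Equiv.Perm C, W.map τ.toEmbedding = W →
    ∀ M, h (rename τ M) = (h M).map τ.toEmbedding
  absorb : ∀ M c, h M = {c} → ∀ N, ∃ j : ℕ, h (j • M + N) = {c}
  nonImposing : ∀ c, c ∉ W → ∃ M, h M = {c}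

namespace IsProperRule

variable {W : Finset C} {h : Multiset (Finset C) → Finset C}

lemma notMem (hr : IsProperRule W h) {M : Multiset (Finset C)} {c : C} (hc : c ∈ h M) : c ∉ W := by
  simpa using hr.subset M hc

lemma mem_rename (hr : IsProperRule W h) {τ : Equiv.Perm C} (hτ : W.map τ.toEmbedding = W)
    {M : Multiset (Finset C)} {c : C} : τ c ∈ h (ABCVoting.rename τ M) ↔ c ∈ h M := by
  simp [hr.rename τ hτ]

lemma rename_singleton (hr : IsProperRule W h) {τ : Equiv.Perm C} (hτ : W.map τ.toEmbedding = W)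
    {M : Multiset (Finset C)} {c : C} (hM : h M = {c}) :
    h (ABCVoting.rename τ M) = {τ c} := by
  rw [hr.rename τ hτ, hM, Finset.map_singleton]; rfl

/-- Iterated consistency. The common winner `d` keeps every intersection non-empty, and `e ∉ W` is
what remains for the empty sum. -/
lemma mem_sum (hr : IsProperRule W h) {I : Type*} {s : Finset I} {M : I → Multiset (Finset C)}
    {d : C} (hd : d ∉ W) (hM : ∀ i ∈ s, d ∈ h (M i)) {e : C} :
    e ∈ h (∑ i ∈ s, M i) ↔ e ∉ W ∧ ∀ i ∈ s, e ∈ h (M i) := by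
  classical
  induction s using Finset.induction_on generalizing e with
  | empty => simp [hr.zero]
  | insert i s hi ih =>
    have hs : ∀ i ∈ s, d ∈ h (M i) := fun j hj => hM j (Finset.mem_insert_of_mem hj)
    have h1 : d ∈ h (M i) ∩ h (∑ i ∈ s, M i) :=
      Finset.mem_inter.mpr ⟨hM i (Finset.mem_insert_self _ _), (ih hs).mpr ⟨hd, hs⟩⟩
    rw [Finset.sum_insert hi, hr.add _ _ ⟨d, h1⟩, Finset.mem_inter, ih hs]
    simp only [Finset.mem_insert, forall_eq_or_imp]
    tauto

lemma sum_eq_singleton (hr : IsProperRule W h) {I : Type*} {s : Finset I}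
    {M : I → Multiset (Finset C)} {c : C} (hs : s.Nonempty) (hM : ∀ i ∈ s, h (M i) = {c}) :
    h (∑ i ∈ s, M i) = {c} := by
  obtain ⟨i, hi⟩ := hs
  have hc : c ∉ W := hr.notMem (M := M i) (by simp [hM i hi])
  ext e
  rw [hr.mem_sum hc fun i hi => by simp [hM i hi]]
  constructor
  · rintro ⟨-, h⟩
    have := h i hi
    rwa [hM i hi] at this
  · intro he
    rw [Finset.mem_singleton] at he
    subst he
    exact ⟨hc, fun i hi => by simp [hM i hi]⟩

lemma mem_nsmul (hr : IsProperRule W h) {M : Multiset (Finset C)} {c : C} (hc : c ∈ h M) (n : ℕ) :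
    c ∈ h (n • M) := by
  rw [← Finset.card_range n, ← Finset.sum_const, hr.mem_sum (hr.notMem hc) fun _ _ => hc]
  exact ⟨hr.notMem hc, fun _ _ => hc⟩

end IsProperRule

/-! ### Ballot types separating a pair of candidates -/

/-- The types of the ballots that contain `c` but not `d`. -/
def pairTypes (W : Finset C) (c d : C) : Finset (ℕ × ℕ) :=
  (Finset.univ.filter fun S : Finset C => c ∈ S ∧ d ∉ S).image fun S => ((W ∩ S).card, S.card)

lemma mem_pairTypes {W : Finset C} {c d : C} {p : ℕ × ℕ} :
    p ∈ pairTypes W c d ↔ ∃ S : Finset C, (c ∈ S ∧ d ∉ S) ∧ ((W ∩ S).card, S.card) = p := by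
  simp [pairTypes]

lemma mem_pairTypes_of_swap {W S : Finset C} {c d : C} (hc : c ∉ W) (hd : d ∉ W)
    (hcS : c ∉ S) (hdS : d ∈ S) : ((W ∩ S).card, S.card) ∈ pairTypes W c d := by
  refine mem_pairTypes.mpr ⟨S.map (Equiv.swap c d).toEmbedding, ?_, ?_⟩
  · simp [hcS, hdS]
  · rw [card_inter_map (map_swap_eq hc hd), Finset.card_map]

/-- A ballot separating `c` from `d` gives a unit vector and its swapped version the negative. This
turns absorption of multisets into absorption of arbitrary integer vectors. -/
lemma pairCount_surjective {W : Finset C} {c d : C} (hc : c ∉ W) (hd : d ∉ W) :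
    Function.Surjective (pairCount W c d (pairTypes W c d)) := by
  intro y
  have key : y ∈ AddMonoidHom.mrange (pairCount W c d (pairTypes W c d)) := by
    rw [← Finset.univ_sum_single y]
    refine AddSubmonoid.sum_mem _ fun p _ => ?_
    obtain ⟨S, ⟨hcS, hdS⟩, hS⟩ := mem_pairTypes.mp p.2
    obtain ⟨p, hp⟩ := p
    subst hS
    rcases le_total 0 (y ⟨_, hp⟩) with h0 | h0
    · obtain ⟨n, hn⟩ := Int.eq_ofNat_of_zero_le h0
      refine ⟨n • {S}, ?_⟩
      rw [map_nsmul, pairCount_singleton hcS hdS hp, hn, ← Pi.single_smul]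
      simp
    · obtain ⟨n, hn⟩ := Int.eq_ofNat_of_zero_le (Int.neg_nonneg_of_nonpos h0)
      have hT : ((W ∩ S.map (Equiv.swap c d).toEmbedding).card,
          (S.map (Equiv.swap c d).toEmbedding).card) = ((W ∩ S).card, S.card) := by
        rw [card_inter_map (map_swap_eq hc hd), Finset.card_map]
      refine ⟨n • {S.map (Equiv.swap c d).toEmbedding}, ?_⟩
      rw [map_nsmul, pairCount_singleton_neg (by simp [hdS]) (by simp [hcS]) (by rwa [hT]),
        ← Pi.single_smul]
      have : y ⟨_, hp⟩ = -n := by omega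
      rw [this]
      simp only [nsmul_eq_mul, mul_neg, mul_one]
      congr 1
      exact Subtype.ext hT
  exact key

/-- A rule cannot single out `c` at a multiset of ballots in which `c` and `d` are approved equally
often on the ballots of each type. -/
lemma IsProperRule.pairCount_ne_zero {W : Finset C} {h : Multiset (Finset C) → Finset C}
    (hr : IsProperRule W h) {c d : C} (hcd : c ≠ d) (hd : d ∉ W)
    {M : Multiset (Finset C)} (hM : h M = {c}) :
    pairCount W c d (pairTypes W c d) M ≠ 0 := by
  intro h0
  have hc : c ∉ W := hr.notMem (M := M) (by simp [hM])
  set σ := Equiv.swap c d with hσ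
  have hσW : W.map σ.toEmbedding = W := map_swap_eq hc hd
  let G : Finset (Equiv.Perm C) := Finset.univ.filter fun τ =>
    W.map τ.toEmbedding = W ∧ τ c = c ∧ τ d = d
  have hGmul : ∀ τ ∈ G, ∀ τ' : Equiv.Perm C, τ' ∈ G ↔ τ' * τ ∈ G := by
    intro τ hτ τ'
    simp only [G, Finset.mem_filter, Finset.mem_univ, true_and] at hτ ⊢
    have : W.map (τ' * τ).toEmbedding = W.map τ'.toEmbedding := by
      rw [map_perm_mul, hτ.1]
    rw [this, Equiv.Perm.mul_apply, Equiv.Perm.mul_apply, hτ.2.1, hτ.2.2]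
  have hGne : G.Nonempty := ⟨1, by
    simp only [G, Finset.mem_filter, Finset.mem_univ, true_and, Equiv.Perm.one_apply, and_true]
    ext x; rw [Finset.mem_map_equiv]; rfl⟩
  -- Symmetrization over the stabilizer `G` of `W`, `c` and `d`. Since `G` acts transitively on the
  -- ballots of one type that contain `c` but not `d`, `Φ` sees only the type of such a ballot.
  let Φ : Multiset (Finset C) →+ Multiset (Finset C) := ∑ τ ∈ G, ABCVoting.rename τ
  have hΦapp : ∀ M, Φ M = ∑ τ ∈ G, ABCVoting.rename τ M := fun M => by
    simp [Φ, AddMonoidHom.finsetSum_apply]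
  have hΦinv : ∀ τ ∈ G, ∀ M, Φ (ABCVoting.rename τ M) = Φ M := by
    intro τ hτ M
    rw [hΦapp, hΦapp]
    refine Finset.sum_equiv (Equiv.mulRight τ) (fun τ' => hGmul τ hτ τ') fun τ' _ => ?_
    rw [rename_rename]; rfl
  have hΦtype : ∀ R R' : Finset C, c ∈ R → d ∉ R → c ∈ R' → d ∉ R' →
      (W ∩ R).card = (W ∩ R').card → R.card = R'.card → Φ {R} = Φ {R'} ∧
        Φ {R.map σ.toEmbedding} = Φ {R'.map σ.toEmbedding} := by
    intro R R' h1 h2 h3 h4 h5 h6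
    constructor
    · obtain ⟨τ, hτ1, hτ2, hτ3, hτ4⟩ := exists_perm_map_eq hc hd h1 h2 h3 h4 h5 h6
      rw [← hτ4, ← ABCVoting.rename_singleton τ,
        hΦinv τ (by simp only [G, Finset.mem_filter, Finset.mem_univ, true_and]; tauto)]
    · obtain ⟨τ, hτ1, hτ2, hτ3, hτ4⟩ := exists_perm_map_eq (W := W) (c := d) (d := c)
        (R := R.map σ.toEmbedding) (R' := R'.map σ.toEmbedding) hd hc
        (by simp [hσ, h1]) (by simp [hσ, h2]) (by simp [hσ, h3]) (by simp [hσ, h4])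
        (by rw [card_inter_map hσW, card_inter_map hσW, h5])
        (by rw [Finset.card_map, Finset.card_map, h6])
      rw [← hτ4, ← ABCVoting.rename_singleton τ,
        hΦinv τ (by simp only [G, Finset.mem_filter, Finset.mem_univ, true_and]; tauto)]
  -- Multisets have no subtraction; integer multiplicities allow differences.
  let cnt : Multiset (Finset C) →+ (Finset C → ℤ) :=
    { toFun := fun M S => (M.count S : ℤ)
      map_zero' := by ext; simp
      map_add' := fun M N => by ext; simp }
  have hcnt : Function.Injective cnt := by
    intro M N hMN
    ext S
    have : (M.count S : ℤ) = N.count S := congrFun hMN S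
    exact_mod_cast this
  have hrep : ∀ p : pairTypes W c d, ∃ S : Finset C, (c ∈ S ∧ d ∉ S) ∧
      ((W ∩ S).card, S.card) = p.1 := fun p => mem_pairTypes.mp p.2
  choose r hr1 hr2 using hrep
  let E : pairTypes W c d → (Finset C → ℤ) := fun p =>
    cnt (Φ {r p}) - cnt (Φ {(r p).map σ.toEmbedding})
  let Λ : Multiset (Finset C) →+ (Finset C → ℤ) :=
    { toFun := fun M => ∑ p, pairCount W c d (pairTypes W c d) M p • E p
      map_zero' := by simp
      map_add' := fun M N => by simp [add_smul, Finset.sum_add_distrib] }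
  have hσσ : ∀ S : Finset C, (S.map σ.toEmbedding).map σ.toEmbedding = S := by
    intro S; ext x; simp [hσ]
  have hΛsingle : ∀ (S : Finset C) (q : pairTypes W c d) (a : ℤ),
      pairCount W c d (pairTypes W c d) {S} = Pi.single q a → Λ {S} = a • E q := by
    intro S q a hS
    change ∑ p, pairCount W c d (pairTypes W c d) {S} p • E p = _
    rw [hS, Finset.sum_eq_single q (fun p _ hp => by simp [hp]) (by simp)]
    simp
  -- Swapping `c` and `d` changes the symmetrized multiset only through the pair counts. Both sides
  -- are additive, so single ballots suffice.
  have hident : (cnt.comp Φ) = (cnt.comp (Φ.comp (ABCVoting.rename σ))) + Λ := by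
    refine ballotHom_ext fun S => ?_
    simp only [AddMonoidHom.comp_apply, AddMonoidHom.add_apply, ABCVoting.rename_singleton]
    by_cases hcS : c ∈ S <;> by_cases hdS : d ∈ S
    · have : Λ {S} = 0 := by
        change ∑ p, pairCount W c d (pairTypes W c d) {S} p • E p = _
        rw [pairCount_singleton_zero (by tauto)]; simp
      rw [this, map_swap_eq_self (by tauto), add_zero]
    · have hT : ((W ∩ S).card, S.card) ∈ pairTypes W c d :=
        mem_pairTypes.mpr ⟨S, ⟨hcS, hdS⟩, rfl⟩
      rw [hΛsingle S ⟨_, hT⟩ 1 (pairCount_singleton hcS hdS hT), one_smul]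
      have h2 := Prod.ext_iff.mp (hr2 ⟨_, hT⟩)
      obtain ⟨e1, e2⟩ := hΦtype (r ⟨_, hT⟩) S (hr1 _).1 (hr1 _).2 hcS hdS h2.1 h2.2
      simp only [E, e1, e2]
      abel
    · have hT := mem_pairTypes_of_swap hc hd hcS hdS
      rw [hΛsingle S ⟨_, hT⟩ (-1) (pairCount_singleton_neg hcS hdS hT), neg_one_smul]
      have h2 := Prod.ext_iff.mp (hr2 ⟨_, hT⟩)
      obtain ⟨e1, e2⟩ := hΦtype (r ⟨_, hT⟩) (S.map σ.toEmbedding) (hr1 _).1 (hr1 _).2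
        (by simp [hσ, hdS]) (by simp [hσ, hcS])
        (by rw [card_inter_map hσW]; exact h2.1) (by rw [Finset.card_map]; exact h2.2)
      simp only [E, e1, e2, hσσ]
      abel
    · have : Λ {S} = 0 := by
        change ∑ p, pairCount W c d (pairTypes W c d) {S} p • E p = _
        rw [pairCount_singleton_zero (by tauto)]; simp
      rw [this, map_swap_eq_self (by tauto), add_zero]
  have hΛM : Λ M = 0 := by
    change ∑ p, pairCount W c d (pairTypes W c d) M p • E p = _
    rw [h0]; simp
  have hΦM : Φ M = Φ (ABCVoting.rename σ M) := by
    apply hcnt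
    have := DFunLike.congr_fun hident M
    simpa [hΛM] using this
  have h1 : h (Φ M) = {c} := by
    rw [hΦapp]
    refine hr.sum_eq_singleton hGne fun τ hτ => ?_
    simp only [G, Finset.mem_filter, Finset.mem_univ, true_and] at hτ
    rw [hr.rename_singleton hτ.1 hM, hτ.2.1]
  have h2 : h (Φ (ABCVoting.rename σ M)) = {d} := by
    rw [hΦapp]
    refine hr.sum_eq_singleton hGne fun τ hτ => ?_
    simp only [G, Finset.mem_filter, Finset.mem_univ, true_and] at hτ
    rw [hr.rename_singleton hτ.1 (hr.rename_singleton hσW hM), hσ, Equiv.swap_apply_left, hτ.2.2]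
  rw [← hΦM, h1, Finset.singleton_inj] at h2
  exact hcd h2

end ABCVoting

/-! ### Weights from the separating functional -/

namespace ABCVoting

variable {C : Type*} [Fintype C] [DecidableEq C]

namespace IsProperRule

variable {W : Finset C} {h : Multiset (Finset C) → Finset C}

lemma exists_weights_of_pair (hr : IsProperRule W h) {c d : C} (hcd : c ≠ d) (hc : c ∉ W)
    (hd : d ∉ W) :
    ∃ v : ℕ → ℕ → ℝ, ∀ M, h M = {c} → ballotScore v W d M < ballotScore v W c M := by
  obtain ⟨w, hw⟩ := exists_pos_functional_of_semigroup
    (D := pairCount W c d (pairTypes W c d) '' {M | h M = {c}})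
    (Set.Nonempty.image _ (hr.nonImposing c hc))
    (by
      rintro _ ⟨M, hM : h M = {c}, rfl⟩ _ ⟨N, hN : h N = {c}, rfl⟩
      refine ⟨M + N, ?_, map_add _ _ _⟩
      rw [Set.mem_ofPred_eq, hr.add M N (by simp [hM, hN]), hM, hN, Finset.inter_self])
    (by
      rintro ⟨M, hM, h0⟩
      exact hr.pairCount_ne_zero hcd hd hM h0)
    (by
      rintro _ ⟨M, hM, rfl⟩ y
      obtain ⟨N, rfl⟩ := pairCount_surjective hc hd y
      obtain ⟨j, hj⟩ := hr.absorb M c hM N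
      exact ⟨j, j • M + N, hj, by rw [map_add, map_nsmul]⟩)
  -- The default `0` is harmless: no ballot of any other type separates `c` from `d`.
  let v : ℕ → ℕ → ℝ := fun a b => if hab : (a, b) ∈ pairTypes W c d then w ⟨_, hab⟩ else 0
  let Λ : Multiset (Finset C) →+ ℝ :=
    { toFun := fun M => ∑ p, w p * pairCount W c d (pairTypes W c d) M p
      map_zero' := by simp
      map_add' := fun M N => by simp [mul_add, Finset.sum_add_distrib] }
  have hΛ : ∀ (S : Finset C) (q : pairTypes W c d) (a : ℤ),
      pairCount W c d (pairTypes W c d) {S} = Pi.single q a → Λ {S} = w q * a := by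
    intro S q a hS
    change ∑ p, w p * pairCount W c d (pairTypes W c d) {S} p = _
    rw [hS, Finset.sum_eq_single q (fun p _ hp => by simp [hp]) (by simp)]
    simp
  have hident : ballotScore v W c = ballotScore v W d + Λ := by
    refine ballotHom_ext fun S => ?_
    simp only [AddMonoidHom.add_apply, ballotScore, ballotSum_singleton]
    by_cases hcS : c ∈ S <;> by_cases hdS : d ∈ S
    · have : Λ {S} = 0 := by
        change ∑ p, w p * pairCount W c d (pairTypes W c d) {S} p = _
        rw [pairCount_singleton_zero (by tauto)]; simp
      simp [this, hcS, hdS]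
    · have hT : ((W ∩ S).card, S.card) ∈ pairTypes W c d :=
        mem_pairTypes.mpr ⟨S, ⟨hcS, hdS⟩, rfl⟩
      rw [hΛ S ⟨_, hT⟩ 1 (pairCount_singleton hcS hdS hT)]
      simp [hcS, hdS, v, hT]
    · have hT := mem_pairTypes_of_swap hc hd hcS hdS
      rw [hΛ S ⟨_, hT⟩ (-1) (pairCount_singleton_neg hcS hdS hT)]
      simp [hcS, hdS, v, hT]
    · have : Λ {S} = 0 := by
        change ∑ p, w p * pairCount W c d (pairTypes W c d) {S} p = _
        rw [pairCount_singleton_zero (by tauto)]; simp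
      simp [this, hcS, hdS]
  refine ⟨v, fun M hM => ?_⟩
  rw [hident, AddMonoidHom.add_apply]
  have : 0 < Λ M := hw _ ⟨M, hM, rfl⟩
  linarith

/-- Weights separating one pair of candidates separate all pairs. -/
lemma score_lt_of_eq_singleton (hr : IsProperRule W h) {v : ℕ → ℕ → ℝ} {c₀ d₀ : C} (h₀ : c₀ ≠ d₀)
    (hc₀ : c₀ ∉ W) (hd₀ : d₀ ∉ W)
    (hv : ∀ M, h M = {c₀} → ballotScore v W d₀ M < ballotScore v W c₀ M) {c d : C} (hcd : c ≠ d)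
    (hd : d ∉ W) {M : Multiset (Finset C)} (hM : h M = {c}) :
    ballotScore v W d M < ballotScore v W c M := by
  have hc : c ∉ W := hr.notMem (M := M) (by simp [hM])
  have hs : W.map (Equiv.swap c c₀).toEmbedding = W := map_swap_eq hc hc₀
  have hd' : Equiv.swap c c₀ d ∉ W := fun hmem => by
    rw [← hs, Finset.mem_map_equiv, Equiv.symm_apply_apply] at hmem
    exact hd hmem
  have hs' : W.map (Equiv.swap (Equiv.swap c c₀ d) d₀).toEmbedding = W := map_swap_eq hd' hd₀
  obtain ⟨τ, hτ, hτc, hτd⟩ : ∃ τ : Equiv.Perm C, W.map τ.toEmbedding = W ∧ τ c = c₀ ∧ τ d = d₀ := by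
    refine ⟨Equiv.swap (Equiv.swap c c₀ d) d₀ * Equiv.swap c c₀, ?_, ?_, ?_⟩
    · rw [map_perm_mul, hs, hs']
    · have hne : c₀ ≠ Equiv.swap c c₀ d := fun heq =>
        hcd ((Equiv.swap c c₀).injective ((Equiv.swap_apply_left c c₀).trans heq))
      rw [Equiv.Perm.mul_apply, Equiv.swap_apply_left, Equiv.swap_apply_of_ne_of_ne hne h₀]
    · rw [Equiv.Perm.mul_apply, Equiv.swap_apply_left]
  have h1 := hv _ (by rw [hr.rename_singleton hτ hM, hτc])
  rwa [← hτc, ← hτd, ballotScore_rename v hτ, ballotScore_rename v hτ] at h1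

variable {v : ℕ → ℕ → ℝ}

/-- Let `N` single out `c`. Then so does `n • M + N` for every `n`, whereas a score deficit of `c`
against `d` in `M` would outweigh `N` for large `n`. -/
lemma score_le_of_mem (hr : IsProperRule W h)
    (hv : ∀ c d M, c ≠ d → d ∉ W → h M = {c} → ballotScore v W d M < ballotScore v W c M)
    {c d : C} (hd : d ∉ W) {M : Multiset (Finset C)} (hM : c ∈ h M) :
    ballotScore v W d M ≤ ballotScore v W c M := by
  rcases eq_or_ne c d with rfl | hcd
  · exact le_rfl
  obtain ⟨N, hN⟩ := hr.nonImposing c (hr.notMem hM)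
  by_contra! hlt
  obtain ⟨n, hn⟩ := Archimedean.arch (ballotScore v W c N - ballotScore v W d N)
    (sub_pos.mpr hlt)
  have h1 : h (n • M + N) = {c} := by
    have hc := hr.mem_nsmul hM n
    rw [hr.add _ _ ⟨c, by simp [hc, hN]⟩, hN]
    exact Finset.inter_eq_right.mpr (by simpa using hc)
  have h2 := hv c d _ hcd hd h1
  rw [map_add, map_add, map_nsmul, map_nsmul] at h2
  rw [smul_sub] at hn
  linarith

/-- A rule does not discriminate between candidates whose scores are all the same. -/
lemma eq_compl_of_score_eq (hr : IsProperRule W h)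
    (hv : ∀ c d M, c ≠ d → d ∉ W → h M = {c} → ballotScore v W d M < ballotScore v W c M)
    {M : Multiset (Finset C)}
    (hM : ∀ c d, c ∉ W → d ∉ W → ballotScore v W c M = ballotScore v W d M) : h M = Wᶜ := by
  refine Finset.Subset.antisymm (hr.subset M) fun c hcW => ?_
  rw [Finset.mem_compl] at hcW
  by_contra hc
  obtain ⟨d, hd⟩ := hr.nonempty M
  have hdW := hr.notMem hd
  have hdc : d ≠ c := fun heq => hc (heq ▸ hd)
  let s := Wᶜ.erase d
  have hs : ∀ e ∈ s, e ∉ W ∧ e ≠ d := fun e he => by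
    rw [Finset.mem_erase, Finset.mem_compl] at he
    exact he.symm
  -- Every summand still selects `d`, and the summand of `e` rejects `e` just as `M` rejects `c`. So
  -- `N` singles out `d` although its scores for `c` and `d` agree.
  let N := ∑ e ∈ s, ABCVoting.rename (Equiv.swap c e) M
  have hmem : ∀ e ∈ s, d ∈ h (ABCVoting.rename (Equiv.swap c e) M) := by
    intro e he
    have := (hr.mem_rename (map_swap_eq hcW (hs e he).1) (M := M) (c := d)).mpr hd
    rwa [Equiv.swap_apply_of_ne_of_ne hdc (hs e he).2.symm] at this
  have hN : h N = {d} := by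
    ext e
    rw [hr.mem_sum hdW hmem, Finset.mem_singleton]
    constructor
    · rintro ⟨heW, he⟩
      by_contra hed
      have hes : e ∈ s := Finset.mem_erase.mpr ⟨hed, by simpa using heW⟩
      have h1 := he e hes
      have h2 := hr.mem_rename (map_swap_eq hcW heW) (M := M) (c := c)
      rw [Equiv.swap_apply_left] at h2
      exact hc (h2.mp h1)
    · rintro rfl
      exact ⟨hdW, hmem⟩
  have hlt := hv d c N hdc hcW hN
  refine hlt.ne ?_
  rw [map_sum, map_sum]
  refine Finset.sum_congr rfl fun e he => ?_
  have hse := map_swap_eq hcW (hs e he).1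
  have h1 := ballotScore_rename v hse e M
  have h2 := ballotScore_rename v hse d M
  rw [Equiv.swap_apply_right] at h1
  rw [Equiv.swap_apply_of_ne_of_ne hdc (hs e he).2.symm] at h2
  rw [h1, h2]
  exact hM _ _ (hs e he).1 hdW

lemma mem_of_score_le (hr : IsProperRule W h)
    (hv : ∀ c d M, c ≠ d → d ∉ W → h M = {c} → ballotScore v W d M < ballotScore v W c M)
    {c : C} (hcW : c ∉ W) {M : Multiset (Finset C)}
    (hM : ∀ d, d ∉ W → ballotScore v W d M ≤ ballotScore v W c M) : c ∈ h M := by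
  by_contra hc
  obtain ⟨d, hd⟩ := hr.nonempty M
  have hdW := hr.notMem hd
  have heq : ballotScore v W c M = ballotScore v W d M :=
    le_antisymm (hr.score_le_of_mem hv hcW hd) (hM d hdW)
  set σ := Equiv.swap c d with hσ
  have hσW : W.map σ.toEmbedding = W := map_swap_eq hcW hdW
  let G : Finset (Equiv.Perm C) := Finset.univ.filter fun τ => W.map τ.toEmbedding = W
  have hσG : σ ∈ G := by simp [G, hσW]
  let Z := ∑ τ ∈ G, ABCVoting.rename τ M
  -- `Y` stands for `M + Z - σ(M)`, a genuine multiset because `σ(M)` is a summand of `Z`. As `c`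
  -- and `d` tie, `σ(M)` has the scores of `M`, so `Y`, like `Z`, gives all candidates outside `W`
  -- the same score. Hence `h (σ(M)) = h M`, and `d ∈ h M` forces `c ∈ h M`.
  obtain ⟨Y, hYZ⟩ : ∃ Y, Y + ABCVoting.rename σ M = M + Z :=
    ⟨M + ∑ τ ∈ G.erase σ, ABCVoting.rename τ M, by
      rw [add_assoc, Finset.sum_erase_add _ _ hσG]⟩
  have hZinv : ∀ a b, a ∉ W → b ∉ W → ABCVoting.rename (Equiv.swap a b) Z = Z := by
    intro a b ha hb
    have hab := map_swap_eq ha hb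
    simp only [Z]
    rw [map_sum]
    refine Finset.sum_equiv (Equiv.mulLeft (Equiv.swap a b)) (fun τ => ?_) fun τ _ => ?_
    · simp only [G, Finset.mem_filter, Finset.mem_univ, true_and, Equiv.coe_mulLeft]
      rw [map_perm_mul]
      conv_rhs => rw [← hab]
      exact (Finset.map_injective _).eq_iff.symm.trans (by rw [hab])
    · rw [rename_rename]; rfl
  have hZscore : ∀ a b, a ∉ W → b ∉ W → ballotScore v W a Z = ballotScore v W b Z := by
    intro a b ha hb
    have := ballotScore_rename v (map_swap_eq ha hb) a Z
    rwa [hZinv a b ha hb, Equiv.swap_apply_left, eq_comm] at this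
  have hZ : h Z = Wᶜ := hr.eq_compl_of_score_eq hv hZscore
  have hσscore : ∀ e, ballotScore v W e (ABCVoting.rename σ M) = ballotScore v W e M := by
    intro e
    have h1 := ballotScore_rename v hσW (σ e) M
    rw [hσ, Equiv.swap_apply_self] at h1
    rw [hσ, h1]
    rcases eq_or_ne e c with rfl | hec
    · rw [Equiv.swap_apply_left, heq]
    rcases eq_or_ne e d with rfl | hed
    · rw [Equiv.swap_apply_right, heq]
    rw [Equiv.swap_apply_of_ne_of_ne hec hed]
  have hY : h Y = Wᶜ := by
    refine hr.eq_compl_of_score_eq hv fun a b ha hb => ?_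
    have h1 := congrArg (ballotScore v W a) hYZ
    have h2 := congrArg (ballotScore v W b) hYZ
    simp only [map_add, hσscore] at h1 h2
    linarith [hZscore a b ha hb]
  have haddW : ∀ M N, h N = Wᶜ → h (M + N) = h M := by
    intro M N hN
    have hinter : h M ∩ h N = h M := by rw [hN]; exact Finset.inter_eq_left.mpr (hr.subset M)
    rw [hr.add M N (by rw [hinter]; exact hr.nonempty M), hinter]
  have h1 : h (ABCVoting.rename σ M) = h M := by
    rw [← haddW _ Y hY, add_comm, hYZ, haddW M Z hZ]
  apply hc
  rw [← h1, ← Equiv.swap_apply_right c d, ← hσ, hr.mem_rename hσW]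
  exact hd

/-- Every complete, consistent and proper rule is a weighted approval rule. -/
theorem exists_weights (hr : IsProperRule W h) :
    ∃ v : ℕ → ℕ → ℝ, ∀ M c, c ∈ h M ↔
      c ∉ W ∧ ∀ d, d ∉ W → ballotScore v W d M ≤ ballotScore v W c M := by
  by_cases hpair : ∃ c d, c ≠ d ∧ c ∉ W ∧ d ∉ W
  · obtain ⟨c₀, d₀, h₀, hc₀, hd₀⟩ := hpair
    obtain ⟨v, hv⟩ := hr.exists_weights_of_pair h₀ hc₀ hd₀
    have hv' : ∀ c d M, c ≠ d → d ∉ W → h M = {c} →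
        ballotScore v W d M < ballotScore v W c M :=
      fun c d M hcd hd hM => hr.score_lt_of_eq_singleton h₀ hc₀ hd₀ hv hcd hd hM
    exact ⟨v, fun M c => ⟨fun hc => ⟨hr.notMem hc, fun d hd => hr.score_le_of_mem hv' hd hc⟩,
      fun hc => hr.mem_of_score_le hv' hc.1 hc.2⟩⟩
  -- Only one candidate lies outside `W`, so any weights work.
  · push Not at hpair
    refine ⟨0, fun M c => ⟨fun hc => ⟨hr.notMem hc, fun d hd => ?_⟩, fun hc => ?_⟩⟩
    · rcases eq_or_ne c d with rfl | hcd
      · exact le_rfl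
      · exact absurd (hpair c d hcd (hr.notMem hc)) (by simpa using hd)
    · obtain ⟨d, hd⟩ := hr.nonempty M
      rcases eq_or_ne c d with rfl | hcd
      · exact hd
      · exact absurd (hpair c d hcd hc.1) (by simpa using hr.notMem hd)

end IsProperRule

end ABCVoting

/-! ### From profiles to multisets of ballots -/

namespace ABCVoting

namespace Profile

variable {C : Type*}

/-- The multiset of ballots of a profile. -/
def ballots (A : Profile C) : Multiset (Finset C) := ∑ i ∈ A.voters, {A.ballot i}

/-- The profile in which the only voter `i` reports `S`. -/
def single (i : ℕ+) (S : Finset C) (hS : S.Nonempty) : Profile C where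
  voters := {i}
  ballot k := if k = i then S else ∅
  voters_nonempty := Finset.singleton_nonempty i
  ballot_nonempty k hk := by simpa [Finset.mem_singleton.mp hk] using hS
  ballot_eq_empty k hk := if_neg (by simpa using hk)

lemma ballots_single (i : ℕ+) (S : Finset C) (hS : S.Nonempty) :
    (single i S hS).ballots = {S} := by simp [ballots, single]

lemma ballots_add {A B : Profile C} (h : A.IsDisjoint B) :
    (A.add B h).ballots = A.ballots + B.ballots := by
  have h' : Disjoint A.voters B.voters := h
  simp only [ballots, add]
  rw [Finset.sum_union h']
  congr 1
  · exact Finset.sum_congr rfl fun i hi => by rw [if_pos hi]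
  · exact Finset.sum_congr rfl fun i hi => by
      rw [if_neg fun hA => Finset.disjoint_left.mp h' hA hi]

lemma ballots_permuteVoters (π : Equiv.Perm ℕ+) (A : Profile C) :
    (A.permuteVoters π).ballots = A.ballots := by
  simp [ballots, permuteVoters]

lemma ballots_permuteCandidates (τ : Equiv.Perm C) (A : Profile C) :
    (A.permuteCandidates τ).ballots = rename τ A.ballots := by
  simp only [ballots, permuteCandidates, map_sum, rename_singleton]

lemma ballots_of_isCopies {j : ℕ} {A B : Profile C} (h : A.IsCopies j B) :
    B.ballots = j • A.ballots := by
  obtain ⟨π, hdisj, hvoters, hballot⟩ := h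
  rw [ballots, hvoters, Finset.sum_biUnion fun s _ t _ hst => hdisj s t hst]
  have : ∀ t, ∑ i ∈ (A.permuteVoters (π t)).voters, {B.ballot i} = A.ballots := by
    intro t
    rw [← ballots_permuteVoters (π t) A]
    exact Finset.sum_congr rfl fun i hi => by rw [hballot t i hi]
  simp [this]

lemma nonempty_of_mem_ballots {A : Profile C} {S : Finset C} (hS : S ∈ A.ballots) :
    S.Nonempty := by
  obtain ⟨i, hi, hiS⟩ := Multiset.mem_sum.mp hS
  rw [Multiset.mem_singleton.mp hiS]
  exact A.ballot_nonempty i hi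

lemma ballots_ne_zero (A : Profile C) : A.ballots ≠ 0 := by
  obtain ⟨i, hi⟩ := A.voters_nonempty
  intro h
  have : A.ballot i ∈ A.ballots := Multiset.mem_sum.mpr ⟨i, hi, Multiset.mem_singleton_self _⟩
  simp [h] at this

/-- The set `F` of forbidden voters allows a profile disjoint from a given one. -/
lemma exists_ballots_eq {M : Multiset (Finset C)} (hM : ∀ S ∈ M, S.Nonempty) (h0 : M ≠ 0)
    (F : Finset ℕ+) : ∃ A : Profile C, A.ballots = M ∧ Disjoint A.voters F := by
  induction M using Multiset.induction with
  | empty => exact absurd rfl h0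
  | cons S M ih =>
    have hS := hM S (Multiset.mem_cons_self S M)
    rcases eq_or_ne M 0 with rfl | hM0
    · obtain ⟨i, hi⟩ := Infinite.exists_notMem_finset F
      exact ⟨single i S hS, ballots_single i S hS, Finset.disjoint_singleton_left.mpr hi⟩
    · obtain ⟨A, hA, hAF⟩ := ih (fun S hS => hM S (Multiset.mem_cons_of_mem hS)) hM0
      obtain ⟨i, hi⟩ := Infinite.exists_notMem_finset (F ∪ A.voters)
      rw [Finset.mem_union, not_or] at hi
      have hdisj : (single i S hS).IsDisjoint A := Finset.disjoint_singleton_left.mpr hi.2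
      refine ⟨(single i S hS).add A hdisj, ?_, ?_⟩
      · rw [ballots_add, ballots_single, hA, Multiset.singleton_add]
      · exact Finset.disjoint_union_left.mpr ⟨Finset.disjoint_singleton_left.mpr hi.1, hAF⟩

lemma exists_ballots_eq_filter [DecidablePred (Finset.Nonempty (α := C))]
    {M : Multiset (Finset C)} (hM : M.filter (·.Nonempty) ≠ 0) (F : Finset ℕ+) :
    ∃ A : Profile C, A.ballots = M.filter (·.Nonempty) ∧ Disjoint A.voters F :=
  exists_ballots_eq (fun _ hS => (Multiset.mem_filter.mp hS).2) hM F

/-- Profiles with the same ballots differ by the names of the voters only. -/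
lemma exists_permuteVoters_eq {A B : Profile C} (h : A.ballots = B.ballots) :
    ∃ π : Equiv.Perm ℕ+, A.permuteVoters π = B := by
  classical
  have hcount : ∀ (A : Profile C) (S : Finset C),
      Fintype.card {i : A.voters // A.ballot i = S} = A.ballots.count S := by
    intro A S
    rw [Fintype.card_subtype, ballots, Multiset.count_sum', ← Finset.sum_coe_sort,
      Finset.card_filter]
    exact Finset.sum_congr rfl fun i _ => by
      rw [Multiset.count_singleton]
      exact if_congr eq_comm rfl rfl
  have e : ∀ S, Nonempty ({i : A.voters // A.ballot i = S} ≃ {i : B.voters // B.ballot i = S}) :=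
    fun S => ⟨Fintype.equivOfCardEq (by rw [hcount, hcount, h])⟩
  let E : A.voters ≃ B.voters :=
    Equiv.ofFiberEquiv (f := fun i : A.voters => A.ballot i) (g := fun i : B.voters => B.ballot i)
      fun S => (e S).some
  have hE : ∀ i : A.voters, B.ballot (E i) = A.ballot i := fun i =>
    Equiv.ofFiberEquiv_map (f := fun i : A.voters => A.ballot i)
      (g := fun i : B.voters => B.ballot i) (fun S => (e S).some) i
  -- The ballot-preserving bijection between the finite electorates extends to a permutation of all
  -- voters.
  obtain ⟨π, hπ⟩ := Equiv.Perm.exists_extending_pair (fun i : A.voters => (i : ℕ+))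
    (fun i => (E i : ℕ+)) Subtype.val_injective (Subtype.val_injective.comp E.injective)
  have hmem : ∀ i, π.symm i ∈ A.voters ↔ i ∈ B.voters := by
    intro i
    constructor
    · intro hi
      have := hπ ⟨_, hi⟩
      simp only [Equiv.apply_symm_apply] at this
      rw [this]
      exact (E _).2
    · intro hi
      have h1 := hπ (E.symm ⟨i, hi⟩)
      simp only [Equiv.apply_symm_apply] at h1
      rw [← h1, Equiv.symm_apply_apply]
      exact (E.symm ⟨i, hi⟩).2
  refine ⟨π, Profile.ext ?_ ?_⟩
  · ext i
    simp [permuteVoters, Finset.mem_map_equiv, hmem]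
  · funext i
    change A.ballot (π.symm i) = B.ballot i
    by_cases hi : π.symm i ∈ A.voters
    · have h1 := hπ ⟨_, hi⟩
      have h2 := hE ⟨_, hi⟩
      simp only [Equiv.apply_symm_apply] at h1
      rw [← h2, ← h1]
    · rw [A.ballot_eq_empty _ hi, B.ballot_eq_empty _ fun h => hi ((hmem i).mpr h)]

end Profile

lemma score_eq_ballotScore {C : Type*} [DecidableEq C] (v : ℕ → ℕ → ℝ) (A : Profile C) (W : Finset C) (c : C) :
    score v A W c = ballotScore v W c A.ballots := by
  simp only [score, Profile.ballots, map_sum, ballotScore, ballotSum_singleton, Finset.sum_filter]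

variable {C : Type*} [Fintype C] [DecidableEq C]

open Classical in
/-- The choice of `g` at `W` in terms of the multiset of non-empty ballots, with all candidates
outside of `W` chosen if there is none. -/
noncomputable def Generator.onBallots (g : Generator C) (W : Finset C) (M : Multiset (Finset C)) :
    Finset C :=
  if hM : ∃ A : Profile C, A.ballots = M.filter (·.Nonempty) then g hM.choose W else Wᶜ

namespace Generator

variable {g : Generator C} {W : Finset C}

lemma onBallots_congr {M N : Multiset (Finset C)}
    (h : M.filter (·.Nonempty) = N.filter (·.Nonempty)) : g.onBallots W M = g.onBallots W N := by
  classical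
  have : ∀ R S : Multiset (Finset C), R = S →
      (if hM : ∃ A : Profile C, A.ballots = R then g hM.choose W else Wᶜ)
        = if hM : ∃ A : Profile C, A.ballots = S then g hM.choose W else Wᶜ := by
    rintro R _ rfl; rfl
  exact this _ _ h

lemma onBallots_eq (hg : g.Anonymous) (hW : W ≠ Finset.univ) {M : Multiset (Finset C)}
    {A : Profile C} (hA : A.ballots = M.filter (·.Nonempty)) : g.onBallots W M = g A W := by
  have hM : ∃ A : Profile C, A.ballots = M.filter (·.Nonempty) := ⟨A, hA⟩
  rw [onBallots, dif_pos hM]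
  obtain ⟨π, hπ⟩ := Profile.exists_permuteVoters_eq (hM.choose_spec.trans hA.symm)
  rw [hg _ W hW π, hπ]

lemma onBallots_ballots (hg : g.Anonymous) (hW : W ≠ Finset.univ) (A : Profile C) :
    g.onBallots W A.ballots = g A W :=
  onBallots_eq hg hW (Multiset.filter_eq_self.mpr fun _ => Profile.nonempty_of_mem_ballots).symm

lemma onBallots_eq_compl {M : Multiset (Finset C)} (hM : M.filter (·.Nonempty) = 0) :
    g.onBallots W M = Wᶜ := by
  rw [onBallots, dif_neg]
  rintro ⟨A, hA⟩
  exact A.ballots_ne_zero (hA.trans hM)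

/-- Each axiom is read off from profiles realizing the non-empty ballots. A multiset without such
ballots is neutral for addition, which settles the cases where no profile exists. -/
lemma isProperRule_onBallots (hproper : g.Proper) (hcons : g.Consistent) (hcomp : g.Complete)
    (hW : W ≠ Finset.univ) : IsProperRule W (g.onBallots W) := by
  have hanon := hproper.anonymous
  have hsub : ∀ M, g.onBallots W M ⊆ Wᶜ := by
    intro M
    unfold onBallots
    split_ifs
    · exact g.subset_compl _ _
    · exact Finset.Subset.refl _
  have hne : ∀ M, (g.onBallots W M).Nonempty := by
    intro M
    unfold onBallots
    split_ifs
    · exact hcomp _ _ hW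
    · rwa [Finset.nonempty_iff_ne_empty, ne_eq, Finset.compl_eq_empty_iff]
  have hzero : ∀ M N : Multiset (Finset C), M.filter (·.Nonempty) = 0 →
      g.onBallots W (M + N) = g.onBallots W N := fun M N hM =>
    onBallots_congr (by rw [Multiset.filter_add, hM, zero_add])
  refine ⟨hsub, hne, onBallots_eq_compl (by simp), ?_, ?_, ?_, ?_⟩
  · intro M N hMN
    by_cases hM : M.filter (·.Nonempty) = 0
    · rw [hzero M N hM, onBallots_eq_compl hM, Finset.inter_eq_right.mpr (hsub N)]
    by_cases hN : N.filter (·.Nonempty) = 0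
    · rw [add_comm, hzero N M hN, onBallots_eq_compl hN, Finset.inter_eq_left.mpr (hsub M)]
    obtain ⟨B, hB, -⟩ := Profile.exists_ballots_eq_filter hN ∅
    obtain ⟨A, hA, hAB⟩ := Profile.exists_ballots_eq_filter hM B.voters
    replace hAB : A.IsDisjoint B := hAB
    have hsum : (A.add B hAB).ballots = (M + N).filter (·.Nonempty) := by
      rw [Profile.ballots_add, hA, hB, Multiset.filter_add]
    rw [onBallots_eq hanon hW hA, onBallots_eq hanon hW hB] at hMN ⊢
    rw [onBallots_eq hanon hW hsum]
    exact hcons A B hAB W hW hMN (hcomp _ _ hW)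
  · intro τ hτ M
    have hfilter : (rename τ M).filter (·.Nonempty) = rename τ (M.filter (·.Nonempty)) := by
      simp only [rename, Multiset.coe_mapAddMonoidHom, Multiset.filter_map]
      congr 1
      exact Multiset.filter_congr fun S _ => by simp
    by_cases hM : M.filter (·.Nonempty) = 0
    · rw [onBallots_eq_compl hM, onBallots_eq_compl (by rw [hfilter, hM, map_zero])]
      ext x
      conv_lhs => rw [← hτ]
      simp [Finset.mem_map_equiv]
    obtain ⟨A, hA, -⟩ := Profile.exists_ballots_eq_filter hM ∅
    have hren : (A.permuteCandidates τ).ballots = (rename τ M).filter (·.Nonempty) := by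
      rw [Profile.ballots_permuteCandidates, hA, hfilter]
    rw [onBallots_eq hanon hW hA, onBallots_eq hanon hW hren, ← hproper.neutral A W hW τ, hτ]
  · intro M c hMc N
    by_cases hM : M.filter (·.Nonempty) = 0
    -- Here `Wᶜ = {c}`, so every multiset selects `{c}`.
    · refine ⟨0, ?_⟩
      rw [onBallots_eq_compl hM] at hMc
      rw [zero_smul, zero_add]
      exact (hne N).subset_singleton_iff.mp (hMc ▸ hsub N)
    by_cases hN : N.filter (·.Nonempty) = 0
    · exact ⟨1, by rw [one_smul, add_comm, hzero N M hN, hMc]⟩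
    obtain ⟨A, hA, -⟩ := Profile.exists_ballots_eq_filter hM ∅
    obtain ⟨B, hB, -⟩ := Profile.exists_ballots_eq_filter hN ∅
    rw [onBallots_eq hanon hW hA] at hMc
    obtain ⟨j, -, A', hcopies, hdisj, hj⟩ := hproper.continuous A B W hW (by simp [hMc])
      (hcomp B W hW)
    refine ⟨j, ?_⟩
    rw [onBallots_eq hanon hW (A := A'.add B hdisj), hj, hMc]
    rw [Profile.ballots_add, Profile.ballots_of_isCopies hcopies, hA, hB, Multiset.filter_add,
      Multiset.filter_nsmul]
  · intro c hc
    obtain ⟨A, hA⟩ := hproper.nonImposing W hW c hc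
    exact ⟨A.ballots, by rw [onBallots_ballots hanon hW, hA]⟩

end Generator

end ABCVoting

theorem mainTheorem4 {C : Type*} [Fintype C] [DecidableEq C] (g : ABCVoting.Generator C)
    (hproper : g.Proper) (hconsistent : g.Consistent) (hcomplete : g.Complete)
    (W : Finset C) (hW : W ≠ Finset.univ) :
    ∃ v : ℕ → ℕ → ℝ, ∀ A : ABCVoting.Profile C, g A W = ABCVoting.weightedApproval v A W := by
  obtain ⟨v, hv⟩ := (ABCVoting.Generator.isProperRule_onBallots hproper hconsistent hcomplete
    hW).exists_weights
  refine ⟨v, fun A => ?_⟩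
  ext c
  rw [← ABCVoting.Generator.onBallots_ballots hproper.anonymous hW, hv]
  simp [ABCVoting.weightedApproval, ABCVoting.score_eq_ballotScore]
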